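/- **Theorem 1.2 (partial variational principle).** Let $(X,d)$ be a compact metric space with its Borel $\sigma$-algebra, let $m\ge 1$, let $f_0,\dots,f_{m-1}:X\to X$ be continuous, and let $\varphi:X\to\mathbb R$ be continuous. Let $\mathscr M(X,f_0,\dots,f_{m-1})$ be the set of Borel probability measures $\mu$ on $X$ with $\mu(f_i^{-1}A)=\mu(A)$ for all Borel $A$ and all $i$, and assume that it is non-empty. *Notation.* For a finite word $w=w_1\cdots w_k$ in the symbols $0,\dots,m-1$ put $|w|=k$ and $f_w=f_{w_1}\circ\cdots\circ f_{w_k}$ (the empty word acts as the identity). Write $w'\le w$ if $w'$ is a suffix of $w$, i.e. $w=w''w'$ for some finite, possibly empty, word $w''$ (so $w$ itself and the empty word are suffixes of $w$). Put $$d_w(x,y)=\max_{w'\le w}d(f_{w'}x,f_{w'}y),\qquad (S_w\varphi)(x)=\sum_{w'\le w}\varphi(f_{w'}x).$$ A set $F\subset X$ is $(w,\varepsilon)$-spanning if every $x\in X$ has some $y\in F$ with $d_w(x,y)<\varepsilon$. Let $B(w,\varepsilon)$ be the minimal cardinality of a $(w,\varepsilon)$-spanning set and $$Q_w(\varphi,\varepsilon)=\inf\Big\{\sum_{x\in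 F}e^{(S_w\varphi)(x)}: F\ \text{is } (w,\varepsilon)\text{-spanning}\Big\}.$$ The topological entropy and the topological pressure are the elements of $[-\infty,\infty]$ $$h(f_0,\dots,f_{m-1})=\lim_{\varepsilon\to0^+}\limsup_{n\to\infty}\frac1n\log\Big(\frac1{m^n}\sum_{|w|=n}B(w,\varepsilon)\Big),$$ $$P(f_0,\dots,f_{m-1},\varphi)=\lim_{\varepsilon\to0^+}\limsup_{n\to\infty}\frac1n\log\Big(\frac1{m^n}\sum_{|w|=n}Q_w(\varphi,\varepsilon)\Big).$$ For a finite measurable partition $\xi=\{A_1,\dots,A_k\}$ put $H_\mu(\xi)=-\sum_i\mu(A_i)\log\mu(A_i)$ (with $0\log 0=0$), and for $\mu\in\mathscr M(X,f_0,\dots,f_{m-1})$ let $$h_\mu(f_0,\dots,f_{m-1})=\sup_{\xi}\ \lim_{n\to\infty}\frac1n\Big[\frac1{m^n}\sum_{|w|=n}H_\mu\Big(\bigvee_{w'\le w}f_{w'}^{-1}\xi\Big)\Big]\in[0,\infty],$$ the supremum being over all finite measurable partitions $\xi$ of $X$ (the limit exists by subadditivity). *Conclusion.* $$\sup\Big\{h_\mu(f_0,\dots,f_{m-1})+\int\varphi\,d\mu\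 :\ \mu\in\mathscr M(X,f_0,\dots,f_{m-1})\Big\}\le P(f_0,\dots,f_{m-1},\varphi),$$ and in particular ($\varphi=0$) $$\sup\big\{h_\mu(f_0,\dots,f_{m-1})\ :\ \mu\in\mathscr M(X,f_0,\dots,f_{m-1})\big\}\le h(f_0,\dots,f_{m-1}).$$ -/

import Mathlib

open MeasureTheory Filter Topology
open scoped ENNReal

noncomputable section

namespace FreeSemigroup

/-! ### Words, the action of words, Bowen metrics -/

/-- The suffixes of a word `w` (the empty word and `w` itself included); `w' ∈ suffixes w` is the
relation `w' ≤ w`. Words over the symbols `0, …, m-1` are lists over `Fin m`. -/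
def suffixes {m : ℕ} (w : List (Fin m)) : Finset (List (Fin m)) := w.tails.toFinset

theorem mem_suffixes {m : ℕ} {w' w : List (Fin m)} :
    w' ∈ suffixes w ↔ ∃ w'' : List (Fin m), w = w'' ++ w' := by
  simp only [suffixes, List.mem_toFinset, List.mem_tails]
  exact ⟨fun ⟨t, h⟩ => ⟨t, h.symm⟩, fun ⟨t, h⟩ => ⟨t, h.symm⟩⟩

theorem suffixes_nonempty {m : ℕ} (w : List (Fin m)) : (suffixes w).Nonempty :=
  ⟨w, mem_suffixes.2 ⟨[], rfl⟩⟩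

/-- `f_w = f_{w₁} ∘ f_{w₂} ∘ ⋯ ∘ f_{w_k}` for `w = w₁ w₂ … w_k`; the empty word acts as the
identity. -/
def wordMap {X : Type*} {m : ℕ} (f : Fin m → X → X) : List (Fin m) → X → X
  | [] => id
  | i :: w => f i ∘ wordMap f w

/-- The Bowen metric `d_w(x, y) = max_{w' ≤ w} d(f_{w'} x, f_{w'} y)`. -/
def bowenDist {X : Type*} [MetricSpace X] {m : ℕ} (f : Fin m → X → X) (w : List (Fin m))
    (x y : X) : ℝ :=
  (suffixes w).sup' (suffixes_nonempty w) fun w' => dist (wordMap f w' x) (wordMap f w' y)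

/-- `F` is a `(w, ε, f₀, …, f_{m-1})`-spanning subset of `X`. -/
def IsSpanning {X : Type*} [MetricSpace X] {m : ℕ} (f : Fin m → X → X) (w : List (Fin m))
    (ε : ℝ) (F : Set X) : Prop :=
  ∀ x : X, ∃ y ∈ F, bowenDist f w x y < ε

/-- The average `m⁻ⁿ ∑_{|w| = n} a(w)` over all words of length `n`. -/
def wordAverage {m : ℕ} (n : ℕ) (a : List (Fin m) → ℝ≥0∞) : ℝ≥0∞ :=
  (∑ w : Fin n → Fin m, a (List.ofFn w)) / (m : ℝ≥0∞) ^ n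

/-! ### Topological entropy -/

/-- `B(w, ε, f₀, …, f_{m-1})`: the minimal cardinality of a `(w, ε)`-spanning set. -/
def spanningNumber {X : Type*} [MetricSpace X] {m : ℕ} (f : Fin m → X → X) (w : List (Fin m))
    (ε : ℝ) : ℝ≥0∞ :=
  ⨅ (F : Finset X) (_ : IsSpanning f w ε (F : Set X)), (F.card : ℝ≥0∞)

/-- `limsup_n (1/n) log B(n, ε, f₀, …, f_{m-1})`. -/
def entropyAtScale {X : Type*} [MetricSpace X] {m : ℕ} (f : Fin m → X → X) (ε : ℝ) : EReal :=
  limsup (fun n : ℕ => ENNReal.log (wordAverage n fun w => spanningNumber f w ε) / (n : EReal))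
    atTop

/-- The topological entropy `h(f₀, …, f_{m-1})`. The limit as `ε → 0⁺` is a supremum by
monotonicity, see `tendsto_topologicalEntropy`. -/
def topologicalEntropy {X : Type*} [MetricSpace X] {m : ℕ} (f : Fin m → X → X) : EReal :=
  ⨆ (ε : ℝ) (_ : 0 < ε), entropyAtScale f ε

/-! ### Topological pressure -/

/-- `(S_w φ)(x) = ∑_{w' ≤ w} φ(f_{w'} x)`. -/
def wordSum {X : Type*} {m : ℕ} (f : Fin m → X → X) (φ : X → ℝ) (w : List (Fin m)) (x : X) : ℝ :=
  ∑ w' ∈ suffixes w, φ (wordMap f w' x)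

/-- `Q_w(f₀, …, f_{m-1}, φ, ε)`: the infimum of `∑_{x ∈ F} exp ((S_w φ)(x))` over the finite
`(w, ε)`-spanning sets `F`. (For continuous `f`, `φ` on a compact space finite spanning sets exist
and an infinite one has an infinite sum.) -/
def pressureSum {X : Type*} [MetricSpace X] {m : ℕ} (f : Fin m → X → X) (φ : X → ℝ)
    (w : List (Fin m)) (ε : ℝ) : ℝ≥0∞ :=
  ⨅ (F : Finset X) (_ : IsSpanning f w ε (F : Set X)),
    ∑ x ∈ F, ENNReal.ofReal (Real.exp (wordSum f φ w x))

/-- `Q(f₀, …, f_{m-1}, φ, ε) = limsup_n (1/n) log Q_n(f₀, …, f_{m-1}, φ, ε)`. -/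
def pressureAtScale {X : Type*} [MetricSpace X] {m : ℕ} (f : Fin m → X → X) (φ : X → ℝ)
    (ε : ℝ) : EReal :=
  limsup (fun n : ℕ => ENNReal.log (wordAverage n fun w => pressureSum f φ w ε) / (n : EReal))
    atTop

/-- The topological pressure `P(f₀, …, f_{m-1}, φ)`. The limit as `ε → 0⁺` is a supremum by
monotonicity, see `tendsto_topologicalPressure`. -/
def topologicalPressure {X : Type*} [MetricSpace X] {m : ℕ} (f : Fin m → X → X) (φ : X → ℝ) :
    EReal :=
  ⨆ (ε : ℝ) (_ : 0 < ε), pressureAtScale f φ ε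

/-! ### The limits as `ε → 0⁺` -/

theorem IsSpanning.mono {X : Type*} [MetricSpace X] {m : ℕ} {f : Fin m → X → X}
    {w : List (Fin m)} {ε₁ ε₂ : ℝ} (h : ε₁ ≤ ε₂) {F : Set X} (hF : IsSpanning f w ε₁ F) :
    IsSpanning f w ε₂ F := fun x =>
  let ⟨y, hy, hxy⟩ := hF x
  ⟨y, hy, hxy.trans_le h⟩

theorem limsup_log_wordAverage_mono {m : ℕ} {a b : List (Fin m) → ℝ≥0∞} (h : ∀ w, a w ≤ b w) :
    limsup (fun n : ℕ => ENNReal.log (wordAverage n a) / (n : EReal)) atTop ≤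
      limsup (fun n : ℕ => ENNReal.log (wordAverage n b) / (n : EReal)) atTop := by
  refine limsup_le_limsup (Eventually.of_forall fun n => ?_)
  refine EReal.div_le_div_right_of_nonneg (by positivity) (ENNReal.log_monotone ?_)
  exact ENNReal.div_le_div_right (Finset.sum_le_sum fun w _ => h _) _

theorem tendsto_iSup_pos {g : ℝ → EReal} (hg : Antitone g) :
    Tendsto g (𝓝[>] 0) (𝓝 (⨆ (ε : ℝ) (_ : 0 < ε), g ε)) := by
  refine tendsto_order.2 ⟨fun a ha => ?_, fun a ha => ?_⟩
  · obtain ⟨ε, hε⟩ := lt_iSup_iff.1 ha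
    obtain ⟨hpos, hε⟩ := lt_iSup_iff.1 hε
    filter_upwards [Ioc_mem_nhdsGT hpos] with δ hδ
    exact hε.trans_le (hg hδ.2)
  · filter_upwards [self_mem_nhdsWithin] with δ hδ
    exact (le_iSup₂ (f := fun (ε : ℝ) (_ : 0 < ε) => g ε) δ hδ).trans_lt ha

theorem tendsto_topologicalEntropy {X : Type*} [MetricSpace X] {m : ℕ} (f : Fin m → X → X) :
    Tendsto (entropyAtScale f) (𝓝[>] 0) (𝓝 (topologicalEntropy f)) :=
  tendsto_iSup_pos fun _ _ h => limsup_log_wordAverage_mono fun _ =>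
    le_iInf₂ fun F hF => iInf₂_le F (hF.mono h)

theorem tendsto_topologicalPressure {X : Type*} [MetricSpace X] {m : ℕ} (f : Fin m → X → X)
    (φ : X → ℝ) :
    Tendsto (pressureAtScale f φ) (𝓝[>] 0) (𝓝 (topologicalPressure f φ)) :=
  tendsto_iSup_pos fun _ _ h => limsup_log_wordAverage_mono fun _ =>
    le_iInf₂ fun F hF => iInf₂_le F (hF.mono h)

/-! ### Measure-theoretic entropy -/

/-- `{A_i}` is a partition of `X` into measurable sets (empty members are harmless). -/
structure IsMeasurablePartition {X ι : Type*} [MeasurableSpace X] (A : ι → Set X) : Prop where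
  measurableSet : ∀ i, MeasurableSet (A i)
  disjoint : Pairwise fun i j => Disjoint (A i) (A j)
  iUnion_eq : ⋃ i, A i = Set.univ

/-- `H_μ(ξ) = - ∑ μ(A_i) log μ(A_i)`, with `0 log 0 = 0`. -/
def partitionEntropy {X ι : Type*} [MeasurableSpace X] [Fintype ι] (μ : Measure X)
    (A : ι → Set X) : ℝ :=
  ∑ i, Real.negMulLog (μ.real (A i))

/-- The join `⋁_{w' ≤ w} f_{w'}⁻¹ ξ`: its members are the sets `⋂_{w' ≤ w} f_{w'}⁻¹ A_{c(w')}`. -/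
def wordJoin {X ι : Type*} {m : ℕ} (f : Fin m → X → X) (A : ι → Set X) (w : List (Fin m)) :
    (suffixes w → ι) → Set X :=
  fun c => ⋂ w' : suffixes w, wordMap f w' ⁻¹' A (c w')

/-- `h_μ(f₀, …, f_{m-1}, ξ) = lim_n (1/n) [m⁻ⁿ ∑_{|w| = n} H_μ(⋁_{w' ≤ w} f_{w'}⁻¹ ξ)]`. For
invariant `μ` the sequence in brackets is subadditive in `n`, so the
limit exists; it is written as a limit superior. -/
def measureEntropyOfPartition {X ι : Type*} [MeasurableSpace X] [Fintype ι] {m : ℕ}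
    (f : Fin m → X → X) (μ : Measure X) (A : ι → Set X) : EReal :=
  limsup (fun n : ℕ => (((1 / (n : ℝ)) * ((1 / (m : ℝ) ^ n) *
    ∑ w : Fin n → Fin m, partitionEntropy μ (wordJoin f A (List.ofFn w))) : ℝ) : EReal)) atTop

/-- The measure-theoretic entropy `h_μ(f₀, …, f_{m-1})`, a supremum over all finite measurable
partitions of `X`. -/
def measureEntropy {X : Type*} [MeasurableSpace X] {m : ℕ} (f : Fin m → X → X)
    (μ : Measure X) : EReal :=
  ⨆ (k : ℕ) (A : Fin k → Set X) (_ : IsMeasurablePartition A), measureEntropyOfPartition f μ A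

/-- `𝓜(X, f₀, …, f_{m-1})`: the probability measures invariant under every `f_i`. -/
def invariantMeasures {X : Type*} [MeasurableSpace X] {m : ℕ} (f : Fin m → X → X) :
    Set (ProbabilityMeasure X) :=
  {μ | ∀ i, MeasurePreserving (f i) (μ : Measure X) (μ : Measure X)}

end FreeSemigroup

end

noncomputable section

namespace FreeSemigroup

/-! ### Entropy of finite partitions -/

/-! Fix an invariant `μ`, a finite partition `A` and `τ > 0`. Each `A i` contains a compact core `B
i`; distinct cores are `2 * ε` apart and the bad set outside all cores has tiny mass. For a word `w`
with `N` suffixes, refine `A` into cores and remainders, and apply the Gibbs inequality to the join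
with the potential `S_w φ` minus `Λ` times the number of visits to the bad set. The sum over names
that results is grouped by spanning points. Along an orbit shadowing a given point, each suffix
allows at most one core symbol, and the remainder symbols weigh `exp (-Λ)` each, so the names
together weigh at most `(1 + card ι * exp (-Λ)) ^ N ≤ exp (N * τ)`. The error is thus arbitrarily
small per suffix, and no passage to iterates is needed to remove a constant such as `log 2`.

The single-word estimate is `exp_partitionEntropy_wordJoin_le`. Its scale `ε` does not depend on `w`
(`exists_scale_forall_exp_partitionEntropy_le`), so Jensen's inequality
(`ofReal_exp_average_le_wordAverage`) carries it over to averages over words; then `n → ∞` and `τ →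
0`. -/

theorem negMulLog_sum_le {κ : Type*} (s : Finset κ) {p : κ → ℝ} (hp : ∀ i, 0 ≤ p i) :
    Real.negMulLog (∑ i ∈ s, p i) ≤ ∑ i ∈ s, Real.negMulLog (p i) := by
  have h : Real.negMulLog (∑ i ∈ s, p i) = ∑ i ∈ s, p i * -Real.log (∑ j ∈ s, p j) := by
    rw [← Finset.sum_mul, Real.negMulLog]; ring
  rw [h]
  refine Finset.sum_le_sum fun i hi => ?_
  rcases (hp i).eq_or_lt with h0 | h0
  · simp [← h0]
  · have := Real.log_le_log h0 (Finset.single_le_sum (f := p) (fun j _ => hp j) hi)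
    rw [Real.negMulLog]
    nlinarith

/-- The finite Gibbs inequality. -/
theorem exp_sum_negMulLog_add_le {κ : Type*} (s : Finset κ) {p a : κ → ℝ}
    (hp : ∀ i ∈ s, 0 < p i) (hs : ∑ i ∈ s, p i = 1) :
    Real.exp (∑ i ∈ s, (Real.negMulLog (p i) + p i * a i)) ≤ ∑ i ∈ s, Real.exp (a i) := by
  have hne : s.Nonempty := by
    by_contra h
    simp [Finset.not_nonempty_iff_eq_empty.1 h] at hs
  set Z := ∑ i ∈ s, Real.exp (a i) with hZ
  have hZpos : 0 < Z := Finset.sum_pos (fun i _ => Real.exp_pos _) hne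
  rw [← Real.le_log_iff_exp_le hZpos]
  -- This is `log t ≤ t - 1` at `t = exp (a i) / (Z * p i)`, multiplied by `p i`; summed over `s`,
  -- the right side cancels to `0`.
  have key : ∀ i ∈ s, Real.negMulLog (p i) + p i * a i - p i * Real.log Z
      ≤ Real.exp (a i) / Z - p i := by
    intro i hi
    have h := Real.log_le_sub_one_of_pos (x := Real.exp (a i) / Z / p i)
      (div_pos (div_pos (Real.exp_pos _) hZpos) (hp i hi))
    rw [Real.log_div (by positivity) (hp i hi).ne', Real.log_div (by positivity) hZpos.ne',
      Real.log_exp] at h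
    have h' := mul_le_mul_of_nonneg_left h (hp i hi).le
    have e : p i * (Real.exp (a i) / Z / p i - 1) = Real.exp (a i) / Z - p i := by
      have := (hp i hi).ne'
      field_simp
    rw [e] at h'
    rw [Real.negMulLog]
    linarith
  have h := Finset.sum_le_sum key
  rw [Finset.sum_sub_distrib, Finset.sum_sub_distrib, ← Finset.sum_mul, hs, ← Finset.sum_div,
    ← hZ, div_self hZpos.ne'] at h
  linarith

section Partition

variable {X : Type*} [MeasurableSpace X] {ι κ : Type*}

theorem IsMeasurablePartition.sum_measureReal [Fintype ι] {A : ι → Set X}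
    (hA : IsMeasurablePartition A) (μ : Measure X) [IsProbabilityMeasure μ] :
    ∑ i, μ.real (A i) = 1 := by
  rw [← measureReal_iUnion_fintype hA.disjoint hA.measurableSet, hA.iUnion_eq, probReal_univ]

/-- Each `A i` is the disjoint union of the `C c` over the fibre of `g` at `i`, and `Real.negMulLog`
is subadditive on nonnegative numbers. -/
theorem partitionEntropy_le_of_refines [Fintype ι] [Fintype κ] (μ : Measure X) [IsFiniteMeasure μ]
    {A : ι → Set X} {C : κ → Set X} (hA : IsMeasurablePartition A) (hC : IsMeasurablePartition C)
    (g : κ → ι) (hg : ∀ c, C c ⊆ A (g c)) :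
    partitionEntropy μ A ≤ partitionEntropy μ C := by
  classical
  have key : ∀ i, μ.real (A i) = ∑ c ∈ Finset.univ.filter (fun c => g c = i), μ.real (C c) := by
    intro i
    rw [← measureReal_biUnion_finset (fun c _ d _ h => hC.disjoint h)
      (fun c _ => hC.measurableSet c)]
    congr 1
    ext x
    simp only [Finset.mem_filter, Finset.mem_univ, true_and, Set.mem_iUnion, exists_prop]
    constructor
    · intro hx
      obtain ⟨c, hc⟩ := Set.mem_iUnion.1 (hC.iUnion_eq.symm ▸ Set.mem_univ x)
      refine ⟨c, ?_, hc⟩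
      by_contra h
      exact Set.disjoint_left.1 (hA.disjoint h) (hg c hc) hx
    · rintro ⟨c, rfl, hc⟩
      exact hg c hc
  unfold partitionEntropy
  rw [← Finset.sum_fiberwise Finset.univ g (fun c => Real.negMulLog (μ.real (C c)))]
  refine Finset.sum_le_sum fun i _ => ?_
  rw [key i]
  exact negMulLog_sum_le _ fun _ => measureReal_nonneg

/-- The Gibbs inequality for a finite partition: entropy plus energy is at most the free energy
computed from suitable points of the members of positive measure. -/
theorem exists_exp_partitionEntropy_add_integral_le [Fintype κ] (μ : Measure X)
    [IsProbabilityMeasure μ] {C : κ → Set X} (hC : IsMeasurablePartition C) {ψ : X → ℝ}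
    (hψ : Integrable ψ μ) :
    ∃ (s : Finset κ) (x : κ → X), (∀ c ∈ s, x c ∈ C c) ∧
      Real.exp (partitionEntropy μ C + ∫ x, ψ x ∂μ) ≤ ∑ c ∈ s, Real.exp (ψ (x c)) := by
  classical
  obtain ⟨x₀⟩ : Nonempty X := nonempty_of_isProbabilityMeasure μ
  have h : ∀ c, ∃ x, μ.real (C c) ≠ 0 → x ∈ C c ∧ ∫ y in C c, ψ y ∂μ ≤ μ.real (C c) * ψ x := by
    intro c
    by_cases hc : μ.real (C c) = 0
    · exact ⟨x₀, fun h => absurd hc h⟩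
    · have hc' : μ (C c) ≠ 0 := fun h => hc (by simp [measureReal_def, h])
      obtain ⟨x, hx, hxe⟩ := exists_setAverage_le hc' (measure_ne_top μ _) hψ.integrableOn
      refine ⟨x, fun _ => ⟨hx, ?_⟩⟩
      rw [setAverage_eq, smul_eq_mul] at hxe
      have hpos : 0 < μ.real (C c) := lt_of_le_of_ne measureReal_nonneg (Ne.symm hc)
      rwa [inv_mul_le_iff₀ hpos] at hxe
  choose x hx using h
  -- Null members are dropped: they may be empty, and they contribute nothing to entropy or
  -- integral.
  refine ⟨Finset.univ.filter fun c => μ.real (C c) ≠ 0, x,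
    fun c hc => (hx c (Finset.mem_filter.1 hc).2).1, ?_⟩
  refine le_trans (Real.exp_le_exp.2 ?_) (exp_sum_negMulLog_add_le _ (p := fun c => μ.real (C c))
    (fun c hc => lt_of_le_of_ne measureReal_nonneg (Ne.symm (Finset.mem_filter.1 hc).2)) ?_)
  · have hint : ∫ x, ψ x ∂μ = ∑ c, ∫ y in C c, ψ y ∂μ := by
      rw [← setIntegral_univ, ← hC.iUnion_eq,
        integral_iUnion_fintype hC.measurableSet hC.disjoint fun _ => hψ.integrableOn]
    rw [hint, partitionEntropy, ← Finset.sum_add_distrib, Finset.sum_filter]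
    refine Finset.sum_le_sum fun c _ => ?_
    split_ifs with hc
    · exact add_le_add le_rfl (hx c hc).2
    · rw [not_not] at hc
      rw [hc, setIntegral_measure_zero]
      · simp
      · rwa [measureReal_eq_zero_iff] at hc
  · rw [Finset.sum_filter_ne_zero]
    exact hC.sum_measureReal μ

end Partition

/-! ### Words -/

theorem suffixes_cons {m : ℕ} (i : Fin m) (w : List (Fin m)) :
    suffixes (i :: w) = insert (i :: w) (suffixes w) := by
  simp [suffixes]

theorem card_suffixes {m : ℕ} (w : List (Fin m)) : (suffixes w).card = w.length + 1 := by
  induction w with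
  | nil => simp [suffixes]
  | cons i w ih =>
    rw [suffixes_cons, Finset.card_insert_of_notMem, ih, List.length_cons]
    intro h
    obtain ⟨t, ht⟩ := mem_suffixes.1 h
    have := congrArg List.length ht
    simp at this
    omega

theorem continuous_wordMap {X : Type*} [TopologicalSpace X] {m : ℕ} {f : Fin m → X → X}
    (hf : ∀ i, Continuous (f i)) (w : List (Fin m)) : Continuous (wordMap f w) := by
  induction w with
  | nil => exact continuous_id
  | cons i w ih => exact (hf i).comp ih

theorem measurePreserving_wordMap {X : Type*} [MeasurableSpace X] {m : ℕ} {f : Fin m → X → X}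
    {μ : Measure X} (hf : ∀ i, MeasurePreserving (f i) μ μ) (w : List (Fin m)) :
    MeasurePreserving (wordMap f w) μ μ := by
  induction w with
  | nil => exact MeasurePreserving.id μ
  | cons i w ih => exact (hf i).comp ih

theorem IsMeasurablePartition.wordJoin {X ι : Type*} [MeasurableSpace X] {m : ℕ}
    {f : Fin m → X → X} {A : ι → Set X} (hA : IsMeasurablePartition A) (w : List (Fin m))
    (hf : ∀ w, Measurable (wordMap f w)) :
    IsMeasurablePartition (wordJoin f A w) where
  measurableSet c := MeasurableSet.iInter fun w' => hf _ (hA.measurableSet _)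
  disjoint c d hcd := by
    obtain ⟨w', h⟩ := Function.ne_iff.1 hcd
    refine Set.disjoint_left.2 fun x hx hy => ?_
    exact Set.disjoint_left.1 (hA.disjoint h) (Set.mem_iInter.1 hx w') (Set.mem_iInter.1 hy w')
  iUnion_eq := by
    refine Set.eq_univ_of_forall fun x => Set.mem_iUnion.2 ?_
    have h : ∀ y, ∃ i, y ∈ A i := fun y =>
      Set.mem_iUnion.1 (hA.iUnion_eq.symm ▸ Set.mem_univ y)
    choose i hi using h
    exact ⟨fun w' => i (wordMap f w' x), Set.mem_iInter.2 fun w' => hi _⟩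

/-- The refinement of `A` by subsets `B i ⊆ A i`: its members are `B i` and `A i \ B i`. -/
def coreRefinement {X ι : Type*} (A B : ι → Set X) : ι × Bool → Set X :=
  fun s => if s.2 then B s.1 else A s.1 \ B s.1

theorem coreRefinement_subset {X ι : Type*} {A B : ι → Set X} (hBA : ∀ i, B i ⊆ A i)
    (s : ι × Bool) : coreRefinement A B s ⊆ A s.1 := by
  rcases s with ⟨i, _ | _⟩
  · simp [coreRefinement]
  · simpa [coreRefinement] using hBA i

theorem IsMeasurablePartition.coreRefinement {X ι : Type*} [MeasurableSpace X] {A B : ι → Set X}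
    (hA : IsMeasurablePartition A) (hB : ∀ i, MeasurableSet (B i)) (hBA : ∀ i, B i ⊆ A i) :
    IsMeasurablePartition (coreRefinement A B) where
  measurableSet := by
    rintro ⟨i, _ | _⟩
    · simpa [FreeSemigroup.coreRefinement] using (hA.measurableSet i).diff (hB i)
    · simpa [FreeSemigroup.coreRefinement] using hB i
  disjoint := by
    rintro ⟨i, b⟩ ⟨j, b'⟩ h
    by_cases hij : i = j
    · subst hij
      have hb : b ≠ b' := fun hb => h (by rw [hb])
      cases b <;> cases b' <;>
        simp_all [FreeSemigroup.coreRefinement, Set.disjoint_sdiff_left, Set.disjoint_sdiff_right]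
    · exact (hA.disjoint hij).mono (coreRefinement_subset hBA _) (coreRefinement_subset hBA _)
  iUnion_eq := by
    refine Set.eq_univ_of_forall fun x => Set.mem_iUnion.2 ?_
    obtain ⟨i, hi⟩ := Set.mem_iUnion.1 (hA.iUnion_eq.symm ▸ Set.mem_univ x)
    by_cases hx : x ∈ B i
    · exact ⟨(i, true), by simpa [FreeSemigroup.coreRefinement] using hx⟩
    · exact ⟨(i, false), by simpa [FreeSemigroup.coreRefinement] using ⟨hi, hx⟩⟩

/-! ### The estimate for a single word -/

/-- By invariance every suffix contributes the same integral. Besides `φ`, this is used for the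
indicator of the bad set, giving the mean number of bad visits. -/
theorem integral_wordSum {X : Type*} [MeasurableSpace X] {m : ℕ} {f : Fin m → X → X} {μ : Measure X}
    (hμ : ∀ i, MeasurePreserving (f i) μ μ) {φ : X → ℝ} (hφ : Integrable φ μ)
    (w : List (Fin m)) :
    Integrable (wordSum f φ w) μ ∧
      ∫ x, wordSum f φ w x ∂μ = (suffixes w).card * ∫ x, φ x ∂μ := by
  have hint : ∀ w', Integrable (fun x => φ (wordMap f w' x)) μ := fun w' =>
    (measurePreserving_wordMap hμ w').integrable_comp_of_integrable hφ
  refine ⟨integrable_finsetSum _ fun w' _ => hint w', ?_⟩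
  unfold wordSum
  rw [integral_finsetSum _ fun w' _ => hint w']
  rw [Finset.sum_congr rfl (g := fun _ => ∫ x, φ x ∂μ), Finset.sum_const, nsmul_eq_mul]
  intro w' _
  have h := measurePreserving_wordMap hμ w'
  rw [← integral_map h.measurable.aemeasurable (by rw [h.map_eq]; exact hφ.1), h.map_eq]

section Word

variable {X : Type*} [MetricSpace X] {m : ℕ} {f : Fin m → X → X}

theorem dist_wordMap_lt_of_bowenDist_lt {w w' : List (Fin m)} {x y : X} {ε : ℝ}
    (h : bowenDist f w x y < ε) (hw : w' ∈ suffixes w) :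
    dist (wordMap f w' x) (wordMap f w' y) < ε :=
  (Finset.le_sup' (fun w' => dist (wordMap f w' x) (wordMap f w' y)) hw).trans_lt h

/-- The names, with respect to the refinement of a partition by separated cores, of the orbit
segments that shadow a given one; names are weighted by the number of visits outside the cores. -/
theorem sum_exp_names_le {σ ι : Type*} [Fintype σ] [Fintype ι] {B : ι → Set X} {ε Λ : ℝ}
    (hsep : ∀ i j, i ≠ j → ∀ x ∈ B i, ∀ y ∈ B j, 2 * ε ≤ dist x y) (z : σ → X)
    (s : Finset (σ → ι × Bool))
    (hs : ∀ c ∈ s, ∀ t, (c t).2 = true → ∃ x ∈ B (c t).1, dist x (z t) < ε) :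
    ∑ c ∈ s, ∏ t, (if (c t).2 = true then 1 else Real.exp (-Λ))
      ≤ (1 + Fintype.card ι * Real.exp (-Λ)) ^ Fintype.card σ := by
  classical
  -- The symbols allowed at `t`. Enlarging `s` to the full product of the `D t` makes the sum of
  -- products factorise.
  let D : σ → Finset (ι × Bool) := fun t =>
    Finset.univ.filter fun a => a.2 = true → ∃ x ∈ B a.1, dist x (z t) < ε
  have hD : ∀ t, ∑ a ∈ D t, (if a.2 = true then (1 : ℝ) else Real.exp (-Λ))
      ≤ 1 + Fintype.card ι * Real.exp (-Λ) := by
    intro t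
    rw [← Finset.sum_filter_add_sum_filter_not (D t) (fun a => a.2 = true)]
    refine add_le_add ?_ ?_
    -- Two distinct cores cannot both meet the open `ε`-ball about `z t`, so at most one core symbol
    -- survives.
    · rw [Finset.sum_congr rfl fun a ha => if_pos (Finset.mem_filter.1 ha).2]
      rw [Finset.sum_const, nsmul_eq_mul, mul_one, Nat.cast_le_one, Finset.card_le_one]
      rintro ⟨i, b⟩ ha ⟨j, b'⟩ hb
      simp only [D, Finset.mem_filter, Finset.mem_univ, true_and] at ha hb
      obtain ⟨ha, rfl⟩ := ha
      obtain ⟨hb, rfl⟩ := hb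
      obtain ⟨x, hx, hxz⟩ := ha rfl
      obtain ⟨y, hy, hyz⟩ := hb rfl
      by_contra hne
      have h1 := hsep i j (fun h => hne (by rw [h])) x hx y hy
      have h2 := dist_triangle_right x y (z t)
      linarith
    · rw [Finset.sum_congr rfl fun a ha => if_neg (Finset.mem_filter.1 ha).2]
      rw [Finset.sum_const, nsmul_eq_mul]
      refine mul_le_mul_of_nonneg_right (Nat.cast_le.2 ?_) (Real.exp_pos _).le
      refine Finset.card_le_card_of_injOn Prod.fst (fun _ _ => Finset.mem_univ _) ?_
      rintro ⟨i, b⟩ ha ⟨j, b'⟩ hb (rfl : i = j)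
      have ha := (Finset.mem_filter.1 ha).2
      have hb := (Finset.mem_filter.1 hb).2
      simp only [Bool.not_eq_true] at ha hb
      rw [ha, hb]
  calc ∑ c ∈ s, ∏ t, (if (c t).2 = true then (1 : ℝ) else Real.exp (-Λ))
      ≤ ∑ c ∈ Fintype.piFinset D, ∏ t, (if (c t).2 = true then (1 : ℝ) else Real.exp (-Λ)) := by
        refine Finset.sum_le_sum_of_subset_of_nonneg (fun c hc => ?_) fun c _ _ =>
          Finset.prod_nonneg fun t _ => by split_ifs <;> positivity
        exact Fintype.mem_piFinset.2 fun t =>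
          Finset.mem_filter.2 ⟨Finset.mem_univ _, hs c hc t⟩
    _ = ∏ t, ∑ a ∈ D t, (if a.2 = true then (1 : ℝ) else Real.exp (-Λ)) :=
        (Finset.prod_univ_sum D fun _ a => if a.2 = true then (1 : ℝ) else Real.exp (-Λ)).symm
    _ ≤ ∏ _t : σ, (1 + Fintype.card ι * Real.exp (-Λ)) :=
        Finset.prod_le_prod (fun t _ => Finset.sum_nonneg fun a _ => by split_ifs <;> positivity)
          fun t _ => hD t
    _ = _ := by rw [Finset.prod_const, Finset.card_univ]

variable [CompactSpace X] [MeasurableSpace X] [BorelSpace X]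

/-- The loss `3 * τ` per suffix has three sources: the mean penalty for bad visits (`hbad`), the
oscillation of `φ` at scale `ε` (`hosc`), and the weighted number of names per spanning point
(`hcard`). -/
theorem exp_partitionEntropy_wordJoin_le {ι : Type*} [Fintype ι] (hf : ∀ i, Continuous (f i))
    {μ : Measure X} [IsProbabilityMeasure μ] (hμ : ∀ i, MeasurePreserving (f i) μ μ)
    {φ : X → ℝ} (hφ : Continuous φ) {A B : ι → Set X} (hA : IsMeasurablePartition A)
    (hB : ∀ i, MeasurableSet (B i)) (hBA : ∀ i, B i ⊆ A i) {ε τ Λ : ℝ} (hΛ : 0 ≤ Λ)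
    (hsep : ∀ i j, i ≠ j → ∀ x ∈ B i, ∀ y ∈ B j, 2 * ε ≤ dist x y)
    (hosc : ∀ x y, dist x y < ε → φ x ≤ φ y + τ)
    (hbad : Λ * μ.real (⋃ i, B i)ᶜ ≤ τ)
    (hcard : 1 + Fintype.card ι * Real.exp (-Λ) ≤ Real.exp τ) {w : List (Fin m)} {F : Finset X}
    (hF : IsSpanning f w ε (F : Set X)) :
    Real.exp (partitionEntropy μ (wordJoin f A w) +
      (suffixes w).card * (∫ x, φ x ∂μ - 3 * τ)) ≤ ∑ y ∈ F, Real.exp (wordSum f φ w y) := by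
  classical
  set bad : Set X := (⋃ i, B i)ᶜ with hbad_def
  set N : ℝ := ((suffixes w).card : ℝ) with hN
  have hbadm : MeasurableSet bad := (MeasurableSet.iUnion hB).compl
  have hwm : ∀ w, Measurable (wordMap f w) := fun w => (continuous_wordMap hf w).measurable
  have hC := (hA.coreRefinement hB hBA).wordJoin w hwm
  have hφi : Integrable φ μ :=
    (BoundedContinuousFunction.mkOfCompact ⟨φ, hφ⟩).integrable μ
  have hindi : Integrable (bad.indicator fun _ => (1 : ℝ)) μ :=
    (integrable_const 1).indicator hbadm
  obtain ⟨hSi, hSe⟩ := integral_wordSum hμ hφi w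
  obtain ⟨hIi, hIe⟩ := integral_wordSum hμ hindi w
  rw [integral_indicator_const _ hbadm, smul_eq_mul, mul_one] at hIe
  obtain ⟨s, x, hxs, hle⟩ := exists_exp_partitionEntropy_add_integral_le μ hC
    (ψ := fun x => wordSum f φ w x - Λ * wordSum f (bad.indicator fun _ => 1) w x)
    (hSi.sub (hIi.const_mul Λ))
  rw [integral_sub hSi (hIi.const_mul Λ), integral_const_mul, hSe, hIe] at hle
  have hH : partitionEntropy μ (wordJoin f A w)
      ≤ partitionEntropy μ (wordJoin f (coreRefinement A B) w) :=
    partitionEntropy_le_of_refines μ (hA.wordJoin w hwm) hC (fun c t => (c t).1) fun c =>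
      Set.iInter_mono fun w' => Set.preimage_mono (coreRefinement_subset hBA _)
  choose y hyF hy using hF
  have hweight : ∀ c ∈ s, Real.exp (wordSum f φ w (x c) -
      Λ * wordSum f (bad.indicator fun _ => 1) w (x c)) ≤
      Real.exp (wordSum f φ w (y (x c)) + N * τ) *
        ∏ t : suffixes w, (if (c t).2 = true then 1 else Real.exp (-Λ)) := by
    intro c hc
    have h1 : wordSum f φ w (x c) ≤ wordSum f φ w (y (x c)) + N * τ := by
      have e : N * τ = ∑ w' ∈ suffixes w, τ := by rw [Finset.sum_const, nsmul_eq_mul]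
      rw [e, wordSum, wordSum, ← Finset.sum_add_distrib]
      exact Finset.sum_le_sum fun w' hw' =>
        hosc _ _ (dist_wordMap_lt_of_bowenDist_lt (hy (x c)) hw')
    have h2 : Real.exp (-(Λ * wordSum f (bad.indicator fun _ => 1) w (x c))) ≤
        ∏ t : suffixes w, (if (c t).2 = true then 1 else Real.exp (-Λ)) := by
      rw [wordSum, Finset.mul_sum, ← Finset.sum_neg_distrib, Real.exp_sum,
        ← Finset.prod_coe_sort]
      refine Finset.prod_le_prod (fun _ _ => (Real.exp_pos _).le) fun t _ => ?_
      have hxt : wordMap f t (x c) ∈ coreRefinement A B (c t) := Set.mem_iInter.1 (hxs c hc) t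
      split_ifs with ht
      · refine Real.exp_le_one_iff.2 (neg_nonpos.2 (mul_nonneg hΛ ?_))
        exact Set.indicator_nonneg (fun _ _ => zero_le_one) _
      -- A point of `A i` outside its own core lies in no other core either, since the `A j` are
      -- disjoint.
      · have hmem : wordMap f t (x c) ∈ bad := by
          simp only [coreRefinement, ht] at hxt
          refine fun hU => ?_
          obtain ⟨j, hj⟩ := Set.mem_iUnion.1 hU
          by_cases hji : j = (c t).1
          · exact hxt.2 (hji ▸ hj)
          · exact Set.disjoint_left.1 (hA.disjoint hji) (hBA j hj) hxt.1
        rw [Set.indicator_of_mem hmem, mul_one]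
    rw [sub_eq_add_neg, Real.exp_add]
    exact mul_le_mul (Real.exp_le_exp.2 h1) h2 (Real.exp_pos _).le (Real.exp_pos _).le
  have hnames : ∀ z, ∑ c ∈ s with y (x c) = z,
      ∏ t : suffixes w, (if (c t).2 = true then 1 else Real.exp (-Λ)) ≤ Real.exp (N * τ) := by
    intro z
    refine (sum_exp_names_le hsep (fun t : suffixes w => wordMap f t z) _ fun c hc t ht => ?_).trans
      ((pow_le_pow_left₀ (by positivity) hcard _).trans_eq ?_)
    · obtain ⟨hcs, rfl⟩ := Finset.mem_filter.1 hc
      refine ⟨wordMap f t (x c), ?_, dist_wordMap_lt_of_bowenDist_lt (hy (x c)) t.2⟩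
      have hxt : wordMap f t (x c) ∈ coreRefinement A B (c t) := Set.mem_iInter.1 (hxs c hcs) t
      simpa [coreRefinement, ht] using hxt
    · rw [Fintype.card_coe, ← Real.exp_nat_mul]
  have hsum : ∑ c ∈ s, Real.exp (wordSum f φ w (x c) -
      Λ * wordSum f (bad.indicator fun _ => 1) w (x c)) ≤
      Real.exp (N * (2 * τ)) * ∑ z ∈ F, Real.exp (wordSum f φ w z) := by
    refine (Finset.sum_le_sum hweight).trans ?_
    rw [← Finset.sum_fiberwise_of_maps_to (fun c _ => hyF (x c)), Finset.mul_sum]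
    refine Finset.sum_le_sum fun z _ => ?_
    calc _ = ∑ c ∈ s with y (x c) = z, Real.exp (wordSum f φ w z + N * τ) *
          ∏ t : suffixes w, (if (c t).2 = true then 1 else Real.exp (-Λ)) :=
        Finset.sum_congr rfl fun c hc => by rw [(Finset.mem_filter.1 hc).2]
      _ ≤ Real.exp (wordSum f φ w z + N * τ) * Real.exp (N * τ) := by
        rw [← Finset.mul_sum]
        exact mul_le_mul_of_nonneg_left (hnames z) (Real.exp_pos _).le
      _ = _ := by rw [← Real.exp_add, ← Real.exp_add]; ring_nf
  have hfin := hle.trans hsum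
  rw [← div_le_iff₀' (Real.exp_pos _), ← Real.exp_sub] at hfin
  refine (Real.exp_le_exp.2 ?_).trans hfin
  have hN0 : 0 ≤ N := Nat.cast_nonneg _
  have := mul_le_mul_of_nonneg_left hbad hN0
  nlinarith

end Word

/-! ### Averages over words -/

/-- Jensen for `exp`: entropies are averaged inside the exponential, pressure sums outside it. -/
theorem ofReal_exp_average_le_wordAverage {m : ℕ} (hm : 1 ≤ m) (n : ℕ) {a : List (Fin m) → ℝ}
    {q : List (Fin m) → ℝ≥0∞} (h : ∀ w, w.length = n → ENNReal.ofReal (Real.exp (a w)) ≤ q w) :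
    ENNReal.ofReal (Real.exp (1 / (m : ℝ) ^ n * ∑ w : Fin n → Fin m, a (List.ofFn w))) ≤
      wordAverage n q := by
  have hm0 : (0 : ℝ) < (m : ℝ) ^ n := pow_pos (by exact_mod_cast hm) n
  have hJ := convexOn_exp.map_sum_le (t := (Finset.univ : Finset (Fin n → Fin m)))
    (w := fun _ => 1 / (m : ℝ) ^ n) (p := fun w => a (List.ofFn w)) (fun _ _ => by positivity)
    (by simp [hm0.ne']) fun _ _ => Set.mem_univ _
  simp only [smul_eq_mul, ← Finset.mul_sum] at hJ
  refine (ENNReal.ofReal_le_ofReal hJ).trans ?_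
  rw [one_div_mul_eq_div, ENNReal.ofReal_div_of_pos hm0,
    ENNReal.ofReal_sum_of_nonneg fun _ _ => (Real.exp_pos _).le,
    ENNReal.ofReal_pow (Nat.cast_nonneg _), ENNReal.ofReal_natCast, wordAverage]
  exact ENNReal.div_le_div_right (Finset.sum_le_sum fun w _ => h _ (List.length_ofFn)) _

/-! ### The partial variational principle -/

variable {X : Type*} [MetricSpace X] [CompactSpace X] [MeasurableSpace X] [BorelSpace X]
  {m : ℕ} {f : Fin m → X → X}

/-- The members of a finite measurable partition contain compact cores which are uniformly
separated and carry almost all of the mass. -/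
theorem IsMeasurablePartition.exists_cores {ι : Type*} [Finite ι] {A : ι → Set X}
    (hA : IsMeasurablePartition A) (μ : Measure X) [IsProbabilityMeasure μ] {η : ℝ} (hη : 0 < η) :
    ∃ B : ι → Set X, (∀ i, B i ⊆ A i) ∧ (∀ i, MeasurableSet (B i)) ∧
      μ.real (⋃ i, B i)ᶜ ≤ η ∧ ∀ᶠ ε : ℝ in 𝓝[>] 0, ∀ i j, i ≠ j → ∀ x ∈ B i, ∀ y ∈ B j,
        2 * ε ≤ dist x y := by
  cases nonempty_fintype ι
  have hι : Nonempty ι := by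
    obtain ⟨x⟩ : Nonempty X := nonempty_of_isProbabilityMeasure μ
    obtain ⟨i, -⟩ := Set.mem_iUnion.1 (hA.iUnion_eq.symm ▸ Set.mem_univ x)
    exact ⟨i⟩
  have hk : (0 : ℝ) < Fintype.card ι := Nat.cast_pos.2 Fintype.card_pos
  have h : ∀ i, ∃ K, K ⊆ A i ∧ IsCompact K ∧ μ.real (A i \ K) ≤ η / Fintype.card ι := by
    intro i
    have hpos : 0 < η / Fintype.card ι := div_pos hη hk
    obtain ⟨K, hKA, hK, hlt⟩ := (hA.measurableSet i).exists_isCompact_lt_add (measure_ne_top μ _)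
      (ENNReal.ofReal_pos.2 hpos).ne'
    refine ⟨K, hKA, hK, ?_⟩
    rw [measureReal_def, measure_sdiff hKA hK.measurableSet.nullMeasurableSet (measure_ne_top μ _)]
    exact ENNReal.toReal_le_of_le_ofReal hpos.le (tsub_le_iff_left.2 hlt.le)
  choose B hBA hB hBη using h
  refine ⟨B, hBA, fun i => (hB i).measurableSet, ?_, ?_⟩
  · have hsub : (⋃ i, B i)ᶜ ⊆ ⋃ i, A i \ B i := by
      intro x hx
      obtain ⟨i, hi⟩ := Set.mem_iUnion.1 (hA.iUnion_eq.symm ▸ Set.mem_univ x)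
      exact Set.mem_iUnion.2 ⟨i, hi, fun h => hx (Set.mem_iUnion.2 ⟨i, h⟩)⟩
    calc μ.real (⋃ i, B i)ᶜ ≤ μ.real (⋃ i, A i \ B i) := measureReal_mono hsub
      _ ≤ ∑ i, μ.real (A i \ B i) := measureReal_iUnion_fintype_le _
      _ ≤ ∑ _i : ι, η / Fintype.card ι := Finset.sum_le_sum fun i _ => hBη i
      _ = η := by
        rw [Finset.sum_const, Finset.card_univ, nsmul_eq_mul]
        field_simp
  · refine eventually_all.2 fun i => eventually_all.2 fun j => ?_
    by_cases hij : i = j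
    · exact Eventually.of_forall fun _ h => absurd hij h
    -- Disjoint compact sets lie at a positive distance `r`, so any `ε ≤ r / 2` works.
    · obtain ⟨r, hr, h⟩ := Metric.exists_pos_forall_lt_edist (hB i) (hB j).isClosed
        ((hA.disjoint hij).mono (hBA i) (hBA j))
      have hr2 : (0 : ℝ) < r / 2 := by positivity
      filter_upwards [Ioc_mem_nhdsGT hr2] with ε hε _ x hx y hy
      have hxy := h x hx y hy
      rw [edist_nndist, ENNReal.coe_lt_coe, ← NNReal.coe_lt_coe, coe_nndist] at hxy
      linarith [hε.2]

/-- The order of choices matters: `Λ` depends on `τ` and `card ι`, the cores then have bad mass at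
most `τ / Λ`, and `ε` comes last, all before `w`. -/
theorem exists_scale_forall_exp_partitionEntropy_le {ι : Type*} [Fintype ι]
    (hf : ∀ i, Continuous (f i)) {μ : Measure X} [IsProbabilityMeasure μ]
    (hμ : ∀ i, MeasurePreserving (f i) μ μ) {φ : X → ℝ} (hφ : Continuous φ) {A : ι → Set X}
    (hA : IsMeasurablePartition A) {τ : ℝ} (hτ : 0 < τ) :
    ∃ ε > 0, ∀ w : List (Fin m), ENNReal.ofReal (Real.exp (partitionEntropy μ (wordJoin f A w) +
      (w.length + 1) * (∫ x, φ x ∂μ - 3 * τ))) ≤ pressureSum f φ w ε := by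
  have hlim : Tendsto (fun Λ : ℝ => 1 + Fintype.card ι * Real.exp (-Λ)) atTop (𝓝 1) := by
    simpa using (Real.tendsto_exp_neg_atTop_nhds_zero.const_mul (Fintype.card ι : ℝ)).const_add 1
  obtain ⟨Λ, hcard, hΛ⟩ := ((hlim.eventually_le_const (Real.one_lt_exp_iff.2 hτ)).and
    (eventually_gt_atTop 0)).exists
  obtain ⟨B, hBA, hB, hbad, hsep⟩ := hA.exists_cores μ (div_pos hτ hΛ)
  obtain ⟨δ, hδ, hosc⟩ := Metric.uniformContinuous_iff.1
    (CompactSpace.uniformContinuous_of_continuous hφ) τ hτ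
  obtain ⟨ε, hsep, hε⟩ := (hsep.and (Ioc_mem_nhdsGT hδ)).exists
  refine ⟨ε, hε.1, fun w => le_iInf₂ fun F hF => ?_⟩
  rw [← ENNReal.ofReal_sum_of_nonneg fun _ _ => (Real.exp_pos _).le]
  refine ENNReal.ofReal_le_ofReal ?_
  have h := exp_partitionEntropy_wordJoin_le hf hμ hφ hA hB hBA hΛ.le hsep (τ := τ)
    (fun x y hxy => ?_) ((le_div_iff₀' hΛ).1 hbad) hcard hF
  · simpa [card_suffixes] using h
  · have := hosc (hxy.trans_le hε.2)
    rw [Real.dist_eq] at this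
    linarith [(abs_lt.1 this).2]

theorem measureEntropyOfPartition_add_integral_le (hm : 1 ≤ m) (hf : ∀ i, Continuous (f i))
    {μ : Measure X} [IsProbabilityMeasure μ] (hμ : ∀ i, MeasurePreserving (f i) μ μ) {φ : X → ℝ}
    (hφ : Continuous φ) {ι : Type*} [Fintype ι] {A : ι → Set X} (hA : IsMeasurablePartition A) :
    measureEntropyOfPartition f μ A ≤ topologicalPressure f φ - ((∫ x, φ x ∂μ : ℝ) : EReal) := by
  set I : ℝ := ∫ x, φ x ∂μ with hI
  -- Three `τ` come from the single-word estimate; the fourth absorbs the excess of the `n + 1`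
  -- suffixes over the divisor `n`.
  suffices h : ∀ τ : ℝ, 0 < τ →
      measureEntropyOfPartition f μ A + ((I - 4 * τ : ℝ) : EReal) ≤ topologicalPressure f φ by
    refine (EReal.le_sub_iff_add_le (.inl (EReal.coe_ne_bot _)) (.inl (EReal.coe_ne_top _))).2 ?_
    have hlim : Tendsto (fun τ : ℝ => measureEntropyOfPartition f μ A +
        ((I - 4 * τ : ℝ) : EReal)) (𝓝[>] 0) (𝓝 (measureEntropyOfPartition f μ A + (I : EReal))) := by
      have hc : Tendsto (fun τ : ℝ => ((I - 4 * τ : ℝ) : EReal)) (𝓝[>] 0) (𝓝 (I : EReal)) := by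
        refine (continuous_coe_real_ereal.tendsto _).comp (Tendsto.mono_left ?_ nhdsWithin_le_nhds)
        exact Continuous.tendsto' (by fun_prop) _ _ (by simp)
      exact (EReal.continuousAt_add (p := (_, (I : EReal))) (.inr (EReal.coe_ne_bot _))
        (.inr (EReal.coe_ne_top _))).tendsto.comp (tendsto_const_nhds.prodMk_nhds hc)
    exact le_of_tendsto hlim (eventually_mem_nhdsWithin.mono fun τ hτ => h τ hτ)
  intro τ hτ
  obtain ⟨ε, hε, hw⟩ := exists_scale_forall_exp_partitionEntropy_le hf hμ hφ hA hτ
  refine le_trans ?_ (le_iSup₂ (f := fun (ε : ℝ) (_ : 0 < ε) => pressureAtScale f φ ε) ε hε)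
  set a : ℕ → ℝ := fun n => (1 / (n : ℝ)) * ((1 / (m : ℝ) ^ n) *
    ∑ w : Fin n → Fin m, partitionEntropy μ (wordJoin f A (List.ofFn w))) with ha
  have hshift : measureEntropyOfPartition f μ A + ((I - 4 * τ : ℝ) : EReal) ≤
      limsup (fun n => (a n : EReal) + ((I - 4 * τ : ℝ) : EReal)) atTop := by
    have := EReal.le_limsup_add (u := fun n => (a n : EReal))
      (v := fun _ => ((I - 4 * τ : ℝ) : EReal)) (f := atTop)
    rwa [liminf_const] at this
  refine hshift.trans (limsup_le_limsup ?_)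
  have hsmall : ∀ᶠ n : ℕ in atTop, -τ ≤ (I - 3 * τ) / (n : ℝ) :=
    (tendsto_const_div_atTop_nhds_zero_nat _).eventually_const_le (neg_lt_zero.2 hτ)
  filter_upwards [hsmall, eventually_gt_atTop 0] with n hn hn0
  have hn0' : (0 : ℝ) < n := Nat.cast_pos.2 hn0
  have havg := ENNReal.log_monotone (ofReal_exp_average_le_wordAverage hm n
    (a := fun w => partitionEntropy μ (wordJoin f A w) + (n + 1) * (I - 3 * τ))
    (q := fun w => pressureSum f φ w ε) fun w hwn => hwn ▸ hw w)
  rw [ENNReal.log_ofReal_of_pos (Real.exp_pos _), Real.log_exp] at havg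
  refine le_trans ?_ (EReal.div_le_div_right_of_nonneg (by positivity) havg)
  have hcast : (n : EReal) = ((n : ℝ) : EReal) := rfl
  rw [hcast, ← EReal.coe_div, ← EReal.coe_add, EReal.coe_le_coe_iff, Finset.sum_add_distrib,
    Finset.sum_const, Finset.card_univ, Fintype.card_fun, Fintype.card_fin, Fintype.card_fin,
    nsmul_eq_mul, Nat.cast_pow]
  have hm0 : (m : ℝ) ^ n ≠ 0 := pow_ne_zero _ (Nat.cast_ne_zero.2 (by omega))
  have hsplit : ∀ S : ℝ, 1 / (m : ℝ) ^ n * (S + (m : ℝ) ^ n * ((n + 1) * (I - 3 * τ))) / n =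
      1 / (n : ℝ) * (1 / (m : ℝ) ^ n * S) + (I - 3 * τ) + (I - 3 * τ) / n := by
    intro S
    field_simp
    ring
  rw [hsplit]
  simp only [ha]
  linarith

theorem measureEntropy_add_integral_le (hm : 1 ≤ m) (hf : ∀ i, Continuous (f i))
    {μ : Measure X} [IsProbabilityMeasure μ] (hμ : ∀ i, MeasurePreserving (f i) μ μ) {φ : X → ℝ}
    (hφ : Continuous φ) :
    measureEntropy f μ + ((∫ x, φ x ∂μ : ℝ) : EReal) ≤ topologicalPressure f φ := by
  -- With the finite integral moved to the right, the supremum over partitions is bounded termwise.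
  refine (EReal.le_sub_iff_add_le (.inl (EReal.coe_ne_bot _)) (.inl (EReal.coe_ne_top _))).1 ?_
  exact iSup_le fun k => iSup₂_le fun A hA =>
    measureEntropyOfPartition_add_integral_le hm hf hμ hφ hA

-- For the zero potential every exponential weight is `1`, so the sums count points.
omit [CompactSpace X] [MeasurableSpace X] [BorelSpace X] in
theorem topologicalPressure_zero (f : Fin m → X → X) :
    topologicalPressure f (fun _ => 0) = topologicalEntropy f := by
  simp [topologicalPressure, topologicalEntropy, pressureAtScale, entropyAtScale, pressureSum,
    spanningNumber, wordSum]

end FreeSemigroup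

end

theorem theorem1p2 {X : Type*} [MetricSpace X] [CompactSpace X] [MeasurableSpace X] [BorelSpace X]
    {m : ℕ} (hm : 1 ≤ m) (f : Fin m → X → X) (hf : ∀ i, Continuous (f i))
    (hM : (FreeSemigroup.invariantMeasures f).Nonempty) (φ : C(X, ℝ)) :
    (⨆ μ ∈ FreeSemigroup.invariantMeasures f,
        (FreeSemigroup.measureEntropy f (μ : Measure X) +
          ((∫ x, φ x ∂(μ : Measure X) : ℝ) : EReal)))
      ≤ FreeSemigroup.topologicalPressure f φ ∧
    (⨆ μ ∈ FreeSemigroup.invariantMeasures f, FreeSemigroup.measureEntropy f (μ : Measure X))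
      ≤ FreeSemigroup.topologicalEntropy f := by
  refine ⟨iSup₂_le fun μ hμ => FreeSemigroup.measureEntropy_add_integral_le hm hf hμ φ.continuous,
    iSup₂_le fun μ hμ => ?_⟩
  have h := FreeSemigroup.measureEntropy_add_integral_le hm hf hμ
    (continuous_const (y := (0 : ℝ)))
  rwa [integral_zero, EReal.coe_zero, add_zero, FreeSemigroup.topologicalPressure_zero] at h
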